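/- For $n\ge 0$ let $F_{2n}$ be the set of fixed-point-free involutions of $S_{2n}$, partially ordered by the restriction $\le$ of the Bruhat–Chevalley order of $S_{2n}$ (the reflexive-transitive closure of the relations $u< ut$, where $t$ is a transposition and $ut$ has more inversions than $u$). Terminology. Write $C(P)$ for the set of covering relations of a finite poset $P$. A map $f:C(P)\to\Gamma$ into a totally ordered set $\Gamma$ is an *EL-labeling* if for all $x<y$ in $P$ there is exactly one saturated chain $x=x_0\lessdot x_1\lessdot\cdots\lessdot x_k=y$ whose label sequence $(f(x_0,x_1),\dots,f(x_{k-1},x_k))$ is weakly increasing, and this sequence is lexicographically smallest among the label sequences of all saturated chains from $x$ to $y$. A finite graded poset with a minimum and a maximum is *EL-shellable* if it has an EL-labeling. For $\sigma\in F_{2n}$, a *free rise* of $\sigma$ is a pair $(i,j)$ with $i<j$ and $\sigma(i)<\sigma(j)$ such that no $k$ satisfies $i<k<j$ and $\sigma(i)<\sigma(k)<\sigma(j)$. It is a *non-crossing $ee$-rise* if $i<j<\sigma(i)<\sigma(j)$, and an *$ed$-rise* if $i<\sigma(i)$ and $\sigma(j)<j$. In both cases let $ct_{(i,j)}(\sigma)=\sigma\cdot(i,j)\cdot(\sigma(i),\sigma(j))$,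 the involution obtained from $\sigma$ by replacing the two cycles $(i,\sigma(i)),(j,\sigma(j))$ by $(i,\sigma(j)),(j,\sigma(i))$. **Theorem.** $(F_{2n},\le)$ is an EL-shellable poset (in particular it is finite and graded, with a minimum and a maximum). More precisely: 1. For $x,y\in F_{2n}$, $y$ covers $x$ in $F_{2n}$ if and only if $y=ct_{(i,j)}(x)$ for some free rise $(i,j)$ of $x$ that is a non-crossing $ee$-rise or an $ed$-rise. 2. For each covering relation $x\lessdot y$ of $F_{2n}$ the pair $(i,j)$ in (1) is unique, and the labeling $f(x,y)=(i,j)$ is an EL-labeling of $F_{2n}$ with values in $\{1,\dots,2n\}^2$ totally ordered by the reverse of the lexicographic order. -/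

import Mathlib

/-! ### Saturated chains, edge labelings and EL-shellability -/

/-- The set `C(P)` of covering relations of `P`. -/
abbrev CoverRel (P : Type) [PartialOrder P] : Type := {p : P × P // p.1 ⋖ p.2}

/-- Saturated chains `x = x₀ ⋖ x₁ ⋖ ⋯ ⋖ x_k = y` from `x` to `y`. -/
inductive SatChain {P : Type} [PartialOrder P] : P → P → Type
  | nil (x : P) : SatChain x x
  | cons {x y z : P} (h : x ⋖ y) (c : SatChain y z) : SatChain x z

namespace SatChain

/-- The number of covering steps of a saturated chain. -/
def length {P : Type} [PartialOrder P] : {x y : P} → SatChain x y → ℕ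
  | _, _, nil _ => 0
  | _, _, cons _ c => c.length + 1

/-- The sequence `(f(x₀,x₁), f(x₁,x₂), …, f(x_{k-1},x_k))` of edge labels of a saturated chain. -/
def labels {P : Type} [PartialOrder P] {Γ : Type} (f : CoverRel P → Γ) :
    {x y : P} → SatChain x y → List Γ
  | _, _, nil _ => []
  | _, _, cons h c => f ⟨(_, _), h⟩ :: c.labels f

end SatChain

/-- An EL-labeling: every nontrivial interval `[x, y]` has a unique saturated chain from `x` to `y`
with weakly increasing label sequence, and this sequence is lexicographically smallest among the
label sequences of all saturated chains from `x` to `y`. -/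
structure IsELLabeling {P : Type} [PartialOrder P] {Γ : Type} [LinearOrder Γ]
    (f : CoverRel P → Γ) : Prop where
  existsUnique_increasing : ∀ x y : P, x < y →
    ∃! c : SatChain x y, (c.labels f).Pairwise (· ≤ ·)
  lex_smallest : ∀ x y : P, x < y → ∀ c d : SatChain x y,
    (c.labels f).Pairwise (· ≤ ·) →
      c.labels f = d.labels f ∨ List.Lex (· < ·) (c.labels f) (d.labels f)

/-- A finite graded poset with a minimum and a maximum is EL-shellable if it has an EL-labeling
with values in some totally ordered set. -/
structure IsELShellable (P : Type) [PartialOrder P] : Prop where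
  finite : Finite P
  exists_min : ∃ b : P, ∀ x, b ≤ x
  exists_max : ∃ t : P, ∀ x, x ≤ t
  graded : ∀ (x y : P) (c d : SatChain x y), c.length = d.length
  exists_labeling : ∃ (Γ : Type) (_ : LinearOrder Γ) (f : CoverRel P → Γ), IsELLabeling f

/-! ### The Bruhat-Chevalley order on permutations -/

/-- The number of inversions (the Coxeter length) of a permutation. -/
def invNumber {m : ℕ} (σ : Equiv.Perm (Fin m)) : ℕ :=
  (Finset.univ.filter fun p : Fin m × Fin m => p.1 < p.2 ∧ σ p.2 < σ p.1).card

/-- `v = u t` for a transposition `t`, with `v` of larger length than `u`. -/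
def BruhatStep {m : ℕ} (u v : Equiv.Perm (Fin m)) : Prop :=
  invNumber u < invNumber v ∧ ∃ i j : Fin m, i ≠ j ∧ v = u * Equiv.swap i j

/-- The Bruhat-Chevalley order on the symmetric group. -/
def BruhatLE {m : ℕ} : Equiv.Perm (Fin m) → Equiv.Perm (Fin m) → Prop :=
  Relation.ReflTransGen BruhatStep

theorem BruhatLE.eq_or_lt {m : ℕ} {u v : Equiv.Perm (Fin m)} (h : BruhatLE u v) :
    u = v ∨ invNumber u < invNumber v := by
  induction h with
  | refl => exact Or.inl rfl
  | tail _ hs ih =>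
    rcases ih with rfl | ih
    · exact Or.inr hs.1
    · exact Or.inr (ih.trans hs.1)

theorem BruhatLE.antisymm {m : ℕ} {u v : Equiv.Perm (Fin m)} (h : BruhatLE u v)
    (h' : BruhatLE v u) : u = v := by
  rcases h.eq_or_lt with e | e
  · exact e
  · rcases h'.eq_or_lt with e' | e'
    · exact e'.symm
    · omega

/-! ### Fixed-point-free involutions -/

/-- The set `F_{2n}` of fixed-point-free involutions of the `2n` points `0, 1, …, 2n - 1`. -/
@[ext] structure FPFInvolution (n : ℕ) : Type where
  perm : Equiv.Perm (Fin (2 * n))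
  involutive : ∀ i, perm (perm i) = i
  fixedPointFree : ∀ i, perm i ≠ i

/-- The restriction of the Bruhat-Chevalley order to fixed-point-free involutions. -/
instance FPFInvolution.instPartialOrder (n : ℕ) : PartialOrder (FPFInvolution n) where
  le x y := BruhatLE x.perm y.perm
  le_refl _ := Relation.ReflTransGen.refl
  le_trans _ _ _ h h' := Relation.ReflTransGen.trans h h'
  le_antisymm _ _ h h' := FPFInvolution.ext (BruhatLE.antisymm h h')

/-! ### Rises and covering transformations -/

/-- `(i, j)` is a free rise of `σ`: `i < j`, `σ i < σ j`, and there is no `k` strictly between `i`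
and `j` with `σ k` strictly between `σ i` and `σ j`. -/
def IsFreeRise {m : ℕ} (σ : Equiv.Perm (Fin m)) (i j : Fin m) : Prop :=
  i < j ∧ σ i < σ j ∧ ¬ ∃ k, i < k ∧ k < j ∧ σ i < σ k ∧ σ k < σ j

/-- A free non-crossing `ee`-rise: both `i` and `j` are exceedances and `i < j < σ i < σ j`. -/
def IsEERise {m : ℕ} (σ : Equiv.Perm (Fin m)) (i j : Fin m) : Prop :=
  IsFreeRise σ i j ∧ i < σ i ∧ j < σ j ∧ j < σ i

/-- A free `ed`-rise: `i` is an exceedance and `j` is a defect. -/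
def IsEDRise {m : ℕ} (σ : Equiv.Perm (Fin m)) (i j : Fin m) : Prop :=
  IsFreeRise σ i j ∧ i < σ i ∧ σ j < j

/-- The covering transformation of a non-crossing `ee`-rise or of an `ed`-rise `(i, j)` of an
involution `σ`: the 2-cycles `(i, σ i)`, `(j, σ j)` are replaced by `(i, σ j)`, `(j, σ i)`. -/
def coveringTransformation {m : ℕ} (σ : Equiv.Perm (Fin m)) (i j : Fin m) :
    Equiv.Perm (Fin m) :=
  σ * Equiv.swap i j * Equiv.swap (σ i) (σ j)

/-- `y` arises from `x` by the covering transformation of the free (non-crossing `ee`- or `ed`-)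
rise `(i, j)` of `x`. -/
def IsRiseMove {n : ℕ} (x y : FPFInvolution n) (i j : Fin (2 * n)) : Prop :=
  (IsEERise x.perm i j ∨ IsEDRise x.perm i j) ∧
    y.perm = coveringTransformation x.perm i j

/-- `f` labels each covering relation `x ⋖ y` of `F_{2n}` by the one pair `(i, j)` whose rise
move leads from `x` to `y`; pairs are totally ordered by the reverse of the lexicographic order. -/
def IsRiseLabeling {n : ℕ}
    (f : CoverRel (FPFInvolution n) → (Fin (2 * n) ×ₗ Fin (2 * n))ᵒᵈ) : Prop :=
  ∀ (e : CoverRel (FPFInvolution n)) (i j : Fin (2 * n)),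
    f e = OrderDual.toDual (toLex (i, j)) ↔ IsRiseMove e.1.1 e.1.2 i j

/-! # The rise labeling of the fixed-point-free involutions is an EL-labeling

The Bruhat order is controlled by the prefix counts `#{k < p | u k < q}`: larger permutations have
pointwise smaller counts. For fixed-point-free involutions the converse holds, with explicit steps.
Suppose the counts of `x` dominate those of `y`, and let `d` be the first position where `x` and `y`
differ. Then `d < x d < y d`, and for the smallest `j > d` with `x d ≤ y j < y d` the pair `(d, j)`
is the rise of a covering transformation with upper element `y`, seen from above as a fall
(`FPFInvolution.IsFall`); its lower element still lies above `x`
(`FPFInvolution.exists_fall_of_prefixCount_le`). Such a step lowers the number of inversions by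
exactly two (`FPFInvolution.IsFall.lower_spec`). Hence the order is the comparison of prefix counts,
the covering relations are the rise moves, and half the number of inversions is a rank function up
to a constant.

The labels decrease in the lexicographic order along increasing chains, so these chains are read
from the top. The pair `(d, j)` above is the lexicographically smallest label of a coatom of
`[x, y]`, and below any other coatom, with label `l`, there is a step inside the interval with a
label smaller than `l` (`FPFInvolution.exists_coatom`). So the last step of an increasing chain is
forced, and such chains are unique. Conversely, a descent `u ⋖ v ⋖ w` can be replaced by
`u ⋖ v' ⋖ w`, where `v'` is the coatom of `[u, w]` just described, and this improves the first label
(`FPFInvolution.exists_bypass`). Repeating such replacements leads from any chain to an increasing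
one that is lexicographically at least as small (`SatChain.exists_increasing_le`), which gives
existence and minimality (`isELLabeling_of_coatoms`).
-/

/-! ### Inversions and prefix counts of permutations -/

theorem sum_sum_eq_of_ne {α : Type*} [Fintype α] [DecidableEq α] {i j : α} (hij : i ≠ j)
    (e : α → α → ℕ) :
    ∑ p, ∑ q, e p q = (e i i + e j j + e i j + e j i) +
      ∑ k ∈ (Finset.univ.erase i).erase j, (e k i + e k j + e i k + e j k) +
      ∑ p ∈ (Finset.univ.erase i).erase j, ∑ q ∈ (Finset.univ.erase i).erase j, e p q := by
  have key : ∀ g : α → ℕ, ∑ p, g p = g i + (g j + ∑ p ∈ (Finset.univ.erase i).erase j, g p) := by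
    intro g
    rw [Finset.add_sum_erase _ g (Finset.mem_erase.2 ⟨hij.symm, Finset.mem_univ j⟩),
      Finset.add_sum_erase _ g (Finset.mem_univ i)]
  simp only [key, Finset.sum_add_distrib]
  ring

theorem invNumber_eq_sum {m : ℕ} (u : Equiv.Perm (Fin m)) :
    invNumber u = ∑ p, ∑ q, if p < q ∧ u q < u p then 1 else 0 := by
  rw [invNumber, Finset.card_filter, ← Finset.univ_product_univ, Finset.sum_product]

theorem invNumber_mul_swap_lt {m : ℕ} (u : Equiv.Perm (Fin m)) {i j : Fin m} (hij : i < j)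
    (hu : u j < u i) : invNumber (u * Equiv.swap i j) < invNumber u := by
  rw [invNumber_eq_sum, invNumber_eq_sum, sum_sum_eq_of_ne hij.ne, sum_sum_eq_of_ne hij.ne]
  have h1 : ∀ k, k ≠ i → k ≠ j → Equiv.swap i j k = k := fun k h h' =>
    Equiv.swap_apply_of_ne_of_ne h h'
  refine add_lt_add_of_lt_of_le (add_lt_add_of_lt_of_le ?_ (Finset.sum_le_sum ?_))
    (Finset.sum_le_sum fun p hp => Finset.sum_le_sum fun q hq => ?_)
  · simp [hij, hu, hij.not_gt, hu.not_gt]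
  · intro k hk
    simp only [Finset.mem_erase, Finset.mem_univ, and_true] at hk
    have hi := u.injective.ne hk.1
    have hj := u.injective.ne hk.2
    simp only [Equiv.Perm.mul_apply, Equiv.swap_apply_left, Equiv.swap_apply_right,
      h1 k hk.2 hk.1]
    grind
  · simp only [Finset.mem_erase, Finset.mem_univ, and_true] at hp hq
    simp [h1 p hp.2 hp.1, h1 q hq.2 hq.1]

theorem invNumber_mul_swap_add_one {m : ℕ} (u : Equiv.Perm (Fin m)) {i j : Fin m} (hij : i < j)
    (hu : u j < u i) (hfree : ∀ k, i < k → k < j → u j < u k → u k < u i → False) :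
    invNumber (u * Equiv.swap i j) + 1 = invNumber u := by
  rw [invNumber_eq_sum, invNumber_eq_sum, sum_sum_eq_of_ne hij.ne, sum_sum_eq_of_ne hij.ne]
  have h1 : ∀ k, k ≠ i → k ≠ j → Equiv.swap i j k = k := fun k h h' =>
    Equiv.swap_apply_of_ne_of_ne h h'
  have hadd : ∀ {a b c a' b' c' : ℕ}, a + 1 = a' → b = b' → c = c' →
      a + b + c + 1 = a' + b' + c' := by omega
  refine hadd ?_ (Finset.sum_congr rfl ?_)
    (Finset.sum_congr rfl fun p hp => Finset.sum_congr rfl fun q hq => ?_)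
  · simp [hij, hu, hij.not_gt, hu.not_gt]
  · intro k hk
    simp only [Finset.mem_erase, Finset.mem_univ, and_true] at hk
    have hi := u.injective.ne hk.1
    have hj := u.injective.ne hk.2
    have hk' := hfree k
    simp only [Equiv.Perm.mul_apply, Equiv.swap_apply_left, Equiv.swap_apply_right,
      h1 k hk.2 hk.1]
    grind
  · simp only [Finset.mem_erase, Finset.mem_univ, and_true] at hp hq
    simp [h1 p hp.2 hp.1, h1 q hq.2 hq.1]

/-- The number of `k < p` with `u k < q`. These numbers determine the Bruhat order: larger
permutations have smaller counts. -/
def prefixCount {m : ℕ} (u : Equiv.Perm (Fin m)) (p q : ℕ) : ℕ :=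
  (Finset.univ.filter fun k : Fin m => (k : ℕ) < p ∧ (u k : ℕ) < q).card

theorem prefixCount_eq_sum {m : ℕ} (u : Equiv.Perm (Fin m)) (p q : ℕ) :
    prefixCount u p q = ∑ k : Fin m, if (k : ℕ) < p ∧ (u k : ℕ) < q then 1 else 0 := by
  rw [prefixCount, Finset.card_filter]

theorem prefixCount_comm {m : ℕ} {u : Equiv.Perm (Fin m)} (hu : ∀ k, u (u k) = k) (p q : ℕ) :
    prefixCount u p q = prefixCount u q p := by
  refine Finset.card_bij (fun k _ => u k) ?_ (fun _ _ _ _ h => u.injective h) ?_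
  · intro k hk
    simp only [Finset.mem_filter, Finset.mem_univ, true_and] at hk ⊢
    rw [hu]; exact hk.symm
  · intro k hk
    simp only [Finset.mem_filter, Finset.mem_univ, true_and] at hk
    exact ⟨u k, by simpa [hu] using hk.symm, hu k⟩

/-- Undoing the inversion of `u` at `i < j` raises the prefix counts by one on a rectangle. -/
theorem prefixCount_mul_swap {m : ℕ} (u : Equiv.Perm (Fin m)) {i j : Fin m} (hij : i < j)
    (hu : u j < u i) (p q : ℕ) :
    prefixCount (u * Equiv.swap i j) p q = prefixCount u p q +
      if ((i : ℕ) < p ∧ p ≤ j) ∧ ((u j : ℕ) < q ∧ q ≤ u i) then 1 else 0 := by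
  have key : ∀ g : Fin m → ℕ,
      ∑ k, g k = g i + (g j + ∑ k ∈ (Finset.univ.erase i).erase j, g k) := by
    intro g
    rw [Finset.add_sum_erase _ g (Finset.mem_erase.2 ⟨hij.ne', Finset.mem_univ j⟩),
      Finset.add_sum_erase _ g (Finset.mem_univ i)]
  rw [prefixCount_eq_sum, prefixCount_eq_sum, key, key]
  have h : ∑ k ∈ (Finset.univ.erase i).erase j,
      (if (k : ℕ) < p ∧ ((u * Equiv.swap i j) k : ℕ) < q then 1 else 0) =
      ∑ k ∈ (Finset.univ.erase i).erase j, if (k : ℕ) < p ∧ (u k : ℕ) < q then 1 else 0 := by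
    refine Finset.sum_congr rfl fun k hk => ?_
    simp only [Finset.mem_erase, Finset.mem_univ, and_true] at hk
    simp [Equiv.swap_apply_of_ne_of_ne hk.2 hk.1]
  rw [h]
  simp only [Equiv.Perm.mul_apply, Equiv.swap_apply_left, Equiv.swap_apply_right]
  rw [Fin.lt_def] at hij hu
  grind

theorem BruhatStep.prefixCount_le {m : ℕ} {u v : Equiv.Perm (Fin m)} (h : BruhatStep u v)
    (p q : ℕ) : prefixCount v p q ≤ prefixCount u p q := by
  obtain ⟨hlt, i, j, hne, rfl⟩ := h
  wlog hij : i < j generalizing i j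
  · rw [Equiv.swap_comm] at hlt ⊢
    exact this j i hne.symm hlt (lt_of_le_of_ne (not_lt.1 hij) hne.symm)
  have hu : u i < u j := by
    rcases lt_trichotomy (u i) (u j) with h | h | h
    · exact h
    · exact absurd (u.injective h) hne
    · exact absurd hlt (invNumber_mul_swap_lt u hij h).not_gt
  have := prefixCount_mul_swap (u * Equiv.swap i j) hij (by simpa using hu) p q
  rw [mul_assoc, Equiv.swap_mul_self, mul_one] at this
  omega

theorem BruhatLE.prefixCount_le {m : ℕ} {u v : Equiv.Perm (Fin m)} (h : BruhatLE u v)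
    (p q : ℕ) : prefixCount v p q ≤ prefixCount u p q := by
  induction h with
  | refl => exact le_rfl
  | tail _ hs ih => exact (hs.prefixCount_le p q).trans ih

/-! ### Falls of a fixed-point-free involution -/

theorem coveringTransformation_apply {m : ℕ} {σ : Equiv.Perm (Fin m)} (hσ : ∀ k, σ (σ k) = k)
    (hfix : ∀ k, σ k ≠ k) {i j : Fin m} (hij : i ≠ j) (h : σ i ≠ j) (k : Fin m) :
    coveringTransformation σ i j k =
      if k = i then σ j else if k = j then σ i else if k = σ i then j else
        if k = σ j then i else σ k := by
  have h1 := hσ i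
  have h2 := hσ j
  have h3 := hfix i
  have h4 := hfix j
  simp only [coveringTransformation, Equiv.Perm.mul_apply, Equiv.swap_apply_def]
  grind

namespace FPFInvolution

variable {n : ℕ}

/-- `(i, j)` is a fall of `y` if `i < y j < y i`, `i < j`, and no `k` strictly between `i` and `j`
has `y k` strictly between `y j` and `y i`. These are the rises `(i, j)` of covering
transformations, seen from the upper element. -/
structure IsFall (y : FPFInvolution n) (i j : Fin (2 * n)) : Prop where
  lt : i < j
  lt_apply : i < y.perm j
  apply_lt : y.perm j < y.perm i
  free : ∀ k, i < k → k < j → y.perm j < y.perm k → y.perm k < y.perm i → False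

variable {x y : FPFInvolution n} {i j : Fin (2 * n)}

theorem IsFall.apply_ne (h : IsFall y i j) : y.perm i ≠ j := by
  rintro rfl
  have := h.lt_apply
  rw [y.involutive] at this
  exact this.false

/-- The involution below `y` in which the cycles through `i` and `j` of a fall `(i, j)` of `y`
have exchanged partners. -/
def IsFall.lower (h : IsFall y i j) : FPFInvolution n where
  perm := coveringTransformation y.perm i j
  involutive k := by
    have hy := coveringTransformation_apply y.involutive y.fixedPointFree h.lt.ne h.apply_ne
    have h1 := y.involutive
    have h2 := y.fixedPointFree
    have h3 := h.lt.ne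
    have h4 := h.apply_ne
    rw [hy, hy]
    grind
  fixedPointFree k := by
    have hy := coveringTransformation_apply y.involutive y.fixedPointFree h.lt.ne h.apply_ne
    have h1 := y.involutive
    have h2 := y.fixedPointFree
    have h3 := h.lt.ne
    have h4 := h.apply_ne
    rw [hy]
    grind

theorem IsFall.lower_perm (h : IsFall y i j) :
    h.lower.perm = coveringTransformation y.perm i j := rfl

theorem IsFall.lower_apply (h : IsFall y i j) (k : Fin (2 * n)) :
    h.lower.perm k = if k = i then y.perm j else if k = j then y.perm i else
      if k = y.perm i then j else if k = y.perm j then i else y.perm k :=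
  coveringTransformation_apply y.involutive y.fixedPointFree h.lt.ne h.apply_ne k

theorem IsFall.lower_apply_left (h : IsFall y i j) : h.lower.perm i = y.perm j := by
  simp [h.lower_apply]

theorem IsFall.lower_apply_right (h : IsFall y i j) : h.lower.perm j = y.perm i := by
  simp [h.lower_apply, h.lt.ne']

theorem IsFall.lower_apply_of_lt (h : IsFall y i j) {k : Fin (2 * n)} (hk : k < i) :
    h.lower.perm k = y.perm k := by
  have h1 := h.lt
  have h2 := h.lt_apply
  have h3 := h.apply_lt
  rw [h.lower_apply, if_neg hk.ne, if_neg (hk.trans h1).ne,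
    if_neg (hk.trans (h2.trans h3)).ne, if_neg (hk.trans h2).ne]

theorem isRiseMove_iff : IsRiseMove x y i j ↔ ∃ h : IsFall y i j, x = h.lower := by
  constructor
  · rintro ⟨hr, hy⟩
    have hij : i < j := by rcases hr with hr | hr <;> exact hr.1.1
    have hx : x.perm i < x.perm j := by rcases hr with hr | hr <;> exact hr.1.2.1
    have hfree : ∀ k, i < k → k < j → x.perm i < x.perm k → x.perm k < x.perm j → False := by
      intro k h1 h2 h3 h4
      rcases hr with hr | hr <;> exact hr.1.2.2 ⟨k, h1, h2, h3, h4⟩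
    have hi : i < x.perm i := by rcases hr with hr | hr <;> exact hr.2.1
    have hd : x.perm j < j ∨ j < x.perm i := by
      rcases hr with hr | hr
      · exact Or.inr hr.2.2.2
      · exact Or.inl hr.2.2
    have hne : x.perm i ≠ j := by
      rintro rfl
      rw [x.involutive] at hx
      exact hi.not_gt hx
    have hv := coveringTransformation_apply x.involutive x.fixedPointFree hij.ne hne
    rw [← hy] at hv
    have yi : y.perm i = x.perm j := by simp [hv]
    have yj : y.perm j = x.perm i := by simp [hv, hij.ne']
    have hf : IsFall y i j := by
      refine ⟨hij, by rwa [yj], by rwa [yi, yj], fun k h1 h2 h3 h4 => ?_⟩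
      have := hfree k h1 h2
      rw [yj, hv] at h3
      rw [yi, hv] at h4
      grind
    refine ⟨hf, FPFInvolution.ext (Equiv.ext fun k => ?_)⟩
    have h1 := x.involutive
    have h2 := x.fixedPointFree
    have h3 := hij.ne
    rw [hf.lower_apply, yi, yj, hv]
    grind
  · rintro ⟨h, rfl⟩
    have xi := h.lower_apply_left
    have xj := h.lower_apply_right
    have hv := h.lower_apply
    have h1 := h.lt
    have h2 := h.lt_apply
    have h3 := h.apply_lt
    have h4 := h.free
    have i1 := y.involutive
    have i2 := y.fixedPointFree
    have hne := h.apply_ne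
    refine ⟨?_, ?_⟩
    · have hfree : IsFreeRise h.lower.perm i j := by
        refine ⟨h1, by rwa [xi, xj], ?_⟩
        rintro ⟨k, k1, k2, k3, k4⟩
        rw [xi, hv] at k3
        rw [xj, hv] at k4
        grind
      by_cases hc : y.perm i < j
      · exact Or.inr ⟨hfree, by rwa [xi], by rwa [xj]⟩
      · refine Or.inl ⟨hfree, by rwa [xi], by rw [xj]; omega, ?_⟩
        rw [xi]
        by_contra hc'
        have := i2 j
        exact h4 (y.perm j) h2 (by omega) (by rw [i1]; omega) (by rw [i1]; omega)
    · refine Equiv.ext fun k => ?_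
      rw [coveringTransformation_apply h.lower.involutive h.lower.fixedPointFree h1.ne
        (by rw [xi]; exact i2 j), xi, xj, hv]
      grind

theorem IsFall.isRiseMove (h : IsFall y i j) : IsRiseMove h.lower y i j :=
  isRiseMove_iff.2 ⟨h, rfl⟩

/-- Passing to the lower element of a fall composes two swaps, each of which removes exactly one
inversion: freeness at `(i, j)` gives, by the symmetry of `y`, freeness at `(y j, y i)`. The prefix
counts grow by one on a rectangle and on its transpose. -/
theorem IsFall.lower_spec (h : IsFall y i j) :
    invNumber h.lower.perm + 2 = invNumber y.perm ∧
    (∀ p q, prefixCount h.lower.perm p q = prefixCount y.perm p q +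
      (if ((i : ℕ) < p ∧ p ≤ j) ∧ ((y.perm j : ℕ) < q ∧ q ≤ y.perm i) then 1 else 0) +
      (if ((y.perm j : ℕ) < p ∧ p ≤ y.perm i) ∧ ((i : ℕ) < q ∧ q ≤ j) then 1 else 0)) ∧
    h.lower < y := by
  have h1 := h.lt
  have h2 := h.lt_apply
  have h3 := h.apply_lt
  have i1 := y.involutive
  have i2 := y.fixedPointFree
  have hne := h.apply_ne
  set y₁ : Equiv.Perm (Fin (2 * n)) := y.perm * Equiv.swap i j with hy₁
  have hperm : h.lower.perm = y₁ * Equiv.swap (y.perm j) (y.perm i) := by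
    rw [h.lower_perm, coveringTransformation, Equiv.swap_comm (y.perm i)]
  have hb : y₁ (y.perm j) = j := by
    rw [hy₁, Equiv.Perm.mul_apply, Equiv.swap_apply_of_ne_of_ne h2.ne' (i2 j), i1]
  have hc : y₁ (y.perm i) = i := by
    rw [hy₁, Equiv.Perm.mul_apply, Equiv.swap_apply_of_ne_of_ne (h2.trans h3).ne' hne, i1]
  have e1 := invNumber_mul_swap_add_one y.perm h1 h3 h.free
  have e2 := invNumber_mul_swap_add_one y₁ h3 (by rwa [hb, hc]) (by
    intro k k1 k2 k3 k4
    rw [hc] at k3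
    rw [hb] at k4
    have hki : k ≠ i := (h2.trans k1).ne'
    have hkj : k ≠ j := by
      rintro rfl
      rw [hy₁, Equiv.Perm.mul_apply, Equiv.swap_apply_right] at k4
      exact k4.not_gt k2
    rw [hy₁, Equiv.Perm.mul_apply, Equiv.swap_apply_of_ne_of_ne hki hkj] at k3 k4
    exact h.free _ k3 k4 (by rwa [i1]) (by rwa [i1]))
  rw [← hperm] at e2
  rw [← hy₁] at e1
  refine ⟨by omega, fun p q => ?_, ?_, ?_⟩
  · have r1 := prefixCount_mul_swap y.perm h1 h3 p q
    have r2 := prefixCount_mul_swap y₁ h3 (by rwa [hb, hc]) p q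
    rw [hb, hc] at r2
    rw [hperm, r2, r1]
  · change BruhatLE h.lower.perm y.perm
    refine Relation.ReflTransGen.tail (Relation.ReflTransGen.single (b := y₁) ?_) ?_
    · refine ⟨by omega, _, _, h3.ne, ?_⟩
      rw [hperm, mul_assoc, Equiv.swap_mul_self, mul_one]
    · refine ⟨by omega, _, _, h1.ne, ?_⟩
      rw [hy₁, mul_assoc, Equiv.swap_mul_self, mul_one]
  · intro hle
    change BruhatLE y.perm h.lower.perm at hle
    rcases hle.eq_or_lt with he | he
    · rw [← he] at e2; omega
    · omega

theorem IsFall.lower_lt (h : IsFall y i j) : h.lower < y := h.lower_spec.2.2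

theorem IsFall.invNumber_lower (h : IsFall y i j) :
    invNumber h.lower.perm + 2 = invNumber y.perm := h.lower_spec.1

end FPFInvolution

/-! ### Descending in an interval -/

theorem exists_first_apply_ne {m : ℕ} {u v : Equiv.Perm (Fin m)} (h : u ≠ v) :
    ∃ d, (∀ k < d, u k = v k) ∧ u d ≠ v d := by
  obtain ⟨d, hd, hmin⟩ := WellFounded.has_min (r := (· < ·)) wellFounded_lt {k | u k ≠ v k} (by
    by_contra hne
    rw [Set.not_nonempty_iff_eq_empty, Set.eq_empty_iff_forall_notMem] at hne
    exact h (Equiv.ext fun k => not_not.1 (hne k)))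
  exact ⟨d, fun k hk => not_not.1 fun hk' => hmin k hk' hk, hd⟩

theorem apply_le_of_prefixCount_le {m : ℕ} {u v : Equiv.Perm (Fin m)}
    (hle : ∀ p q, prefixCount v p q ≤ prefixCount u p q) {d : Fin m}
    (hd : ∀ k < d, u k = v k) : u d ≤ v d := by
  by_contra hlt
  rw [not_le] at hlt
  refine (hle (d + 1) (v d + 1)).not_gt ?_
  rw [prefixCount_eq_sum, prefixCount_eq_sum]
  refine Finset.sum_lt_sum (fun k _ => ?_) ⟨d, Finset.mem_univ d, ?_⟩
  · rcases lt_trichotomy k d with hk | rfl | hk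
    · rw [hd k hk]
    · rw [if_neg (by omega)]; exact Nat.zero_le _
    · rw [if_neg (by omega)]; exact Nat.zero_le _
  · rw [if_neg (by omega), if_pos (by omega)]; exact Nat.one_pos

/-- Comparison of four prefix counts by rows, with one extra unit in row `r`. -/
theorem prefixCount_add_lt {m : ℕ} {u v : Equiv.Perm (Fin m)} {p q p' q' : ℕ} (r : Fin m)
    (h : ∀ k : Fin m, (if (k : ℕ) < p ∧ (v k : ℕ) < q then 1 else 0) +
      (if (k : ℕ) < p' ∧ (u k : ℕ) < q' then 1 else 0) + (if k = r then 1 else 0) ≤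
      (if (k : ℕ) < p ∧ (u k : ℕ) < q then 1 else 0) +
      (if (k : ℕ) < p' ∧ (v k : ℕ) < q' then 1 else 0)) :
    prefixCount v p q + prefixCount u p' q' < prefixCount u p q + prefixCount v p' q' := by
  have := Finset.sum_le_sum fun k (_ : k ∈ Finset.univ) => h k
  simp only [Finset.sum_add_distrib, ← prefixCount_eq_sum] at this
  rw [Finset.sum_ite_eq' Finset.univ r, if_pos (Finset.mem_univ r)] at this
  omega

namespace FPFInvolution

variable {n : ℕ} {x y : FPFInvolution n} {i j d : Fin (2 * n)}

/-- If the prefix counts of `x` dominate those of `y` and `d` is the first position where `x` and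
`y` differ, then the smallest `j > d` with `x d ≤ y j < y d` gives a fall of `y` whose lower element
still has prefix counts dominated by those of `x`. -/
theorem exists_fall_of_prefixCount_le
    (hle : ∀ p q, prefixCount y.perm p q ≤ prefixCount x.perm p q)
    (hd : ∀ k < d, x.perm k = y.perm k) (hne : x.perm d ≠ y.perm d) :
    ∃ j, ∃ h : IsFall y d j, x.perm d ≤ y.perm j ∧
      (∀ k, d < k → k < j → x.perm d ≤ y.perm k → y.perm k < y.perm d → False) ∧
      ∀ p q, prefixCount h.lower.perm p q ≤ prefixCount x.perm p q := by
  have x1 := x.involutive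
  have y1 := y.involutive
  have hac : x.perm d < y.perm d := lt_of_le_of_ne (apply_le_of_prefixCount_le hle hd) hne
  have hda : d < x.perm d := by
    refine lt_of_le_of_ne (not_lt.1 fun h => hne ?_) (x.fixedPointFree d).symm
    have := hd _ h
    rw [x1] at this
    rw [this, y1, ← this]
  have below : ∀ k, y.perm k < d → x.perm k = y.perm k := by
    intro k hk
    have := hd _ hk
    rw [y1] at this
    rw [← this, x1, this]
  obtain ⟨j, ⟨hdj, haj, hjc⟩, hmin⟩ := WellFounded.has_min (r := (· < ·)) wellFounded_lt
    {k | d < k ∧ x.perm d ≤ y.perm k ∧ y.perm k < y.perm d} (by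
      refine ⟨y.perm (x.perm d), ?_, by rw [y1], by rwa [y1]⟩
      rcases lt_trichotomy d (y.perm (x.perm d)) with h | h | h
      · exact h
      · rw [h, y1] at hac
        rw [← h] at hac
        exact absurd hac (lt_irrefl _)
      · have := below _ h
        rw [x1] at this
        rw [← this] at h
        exact absurd h (lt_irrefl _))
  have hfree : ∀ k, d < k → k < j → x.perm d ≤ y.perm k → y.perm k < y.perm d → False :=
    fun k h1 h2 h3 h4 => hmin k ⟨h1, h3, h4⟩ h2
  have hf : IsFall y d j := ⟨hdj, hda.trans_le haj, hjc,
    fun k h1 h2 h3 h4 => hfree k h1 h2 (haj.trans h3.le) h4⟩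
  refine ⟨j, hf, haj, hfree, fun p q => ?_⟩
  -- On the rectangle the counts differ: from column `x d` to column `q`, the rows before `d` gain
  -- equally in `x` and `y`, row `d` gains in `x` only, and later rows gain nothing in `y`.
  have hy1 : ∀ p q : ℕ, ((d : ℕ) < p ∧ p ≤ j) → ((y.perm j : ℕ) < q ∧ q ≤ y.perm d) →
      prefixCount y.perm p q < prefixCount x.perm p q := by
    intro p q hp hq
    have := prefixCount_add_lt (u := x.perm) (v := y.perm) (p := p) (q := q) (p' := p)
      (q' := x.perm d) d (fun k => by
        rcases lt_trichotomy k d with h | h | h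
        · rw [hd k h, if_neg h.ne]; omega
        · subst h
          rw [if_neg (c := _ ∧ (y.perm k : ℕ) < q) (by omega), if_pos (c := k = k) rfl,
            if_pos (c := _ ∧ (x.perm k : ℕ) < q) (by omega), if_neg (by omega)]
          omega
        · rw [if_neg h.ne']
          have e1 : (k : ℕ) < p ∧ (y.perm k : ℕ) < q →
              (k : ℕ) < p ∧ (y.perm k : ℕ) < x.perm d := fun h' =>
            ⟨h'.1, not_le.1 fun h'' => hfree k h (by omega) h'' (by omega)⟩
          have e2 : (k : ℕ) < p ∧ (x.perm k : ℕ) < x.perm d → (k : ℕ) < p ∧ (x.perm k : ℕ) < q := by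
            omega
          split_ifs <;> omega)
    have := hle p (x.perm d)
    omega
  have hy2 : ∀ p q : ℕ, ((y.perm j : ℕ) < p ∧ p ≤ y.perm d) → ((d : ℕ) < q ∧ q ≤ j) →
      prefixCount y.perm p q < prefixCount x.perm p q := by
    intro p q hp hq
    rw [prefixCount_comm y1, prefixCount_comm x1]
    exact hy1 q p hq hp
  rw [hf.lower_spec.2.1]
  by_cases c1 : ((d : ℕ) < p ∧ p ≤ j) ∧ ((y.perm j : ℕ) < q ∧ q ≤ y.perm d)
  · by_cases c2 : ((y.perm j : ℕ) < p ∧ p ≤ y.perm d) ∧ ((d : ℕ) < q ∧ q ≤ j)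
    · rw [if_pos c1, if_pos c2]
      -- Where the rectangle meets its transpose a difference of two is needed: one is present in
      -- row `x d` already, and that row contributes another one.
      have h1 := hy1 (x.perm d) q ⟨hda, by omega⟩ c1.2
      have := prefixCount_add_lt (u := x.perm) (v := y.perm) (p := p) (q := q)
        (p' := x.perm d) (q' := q) (x.perm d) (fun k => by
          by_cases hk : k < x.perm d
          · rw [if_neg hk.ne]
            by_cases hkp : (k : ℕ) < p
            · simp only [hkp, Fin.lt_def.1 hk, true_and]; omega
            · omega
          · by_cases hkp : (k : ℕ) < p
            · have hlow : (y.perm k : ℕ) < q → y.perm k < d := by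
                intro hq
                have h3 := hfree (y.perm k)
                rw [y1] at h3
                have h4 : y.perm k ≠ d := by
                  rintro rfl
                  rw [y1] at c2
                  omega
                have h5 : ¬ d < y.perm k := fun h => h3 h (by omega) (by omega) (by omega)
                omega
              have hyx : (y.perm k : ℕ) < q → (x.perm k : ℕ) < q := by
                intro hq
                rw [below k (hlow hq)]
                exact hq
              by_cases hka : k = x.perm d
              · have : ¬ (y.perm k : ℕ) < q := by
                  intro hq
                  have h5 := hlow hq
                  rw [← below k h5, hka, x1] at h5
                  exact h5.false
                have : (x.perm k : ℕ) < q := by rw [hka, x1]; omega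
                rw [if_pos hka, if_neg (c := _ ∧ (y.perm k : ℕ) < q) (by omega),
                  if_pos (c := (k : ℕ) < p ∧ (x.perm k : ℕ) < q) (by omega),
                  if_neg (c := (k : ℕ) < x.perm d ∧ (x.perm k : ℕ) < q) (by omega)]
                omega
              · simp only [hkp, true_and, if_neg hka]
                split_ifs <;> omega
            · rw [if_neg (by omega), if_neg (by omega), if_neg (by omega)]
              omega)
      omega
    · rw [if_pos c1, if_neg c2]
      have := hy1 p q c1.1 c1.2
      omega
  · rw [if_neg c1]
    split_ifs with c2
    · have := hy2 p q c2.1 c2.2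
      omega
    · exact hle p q

end FPFInvolution

/-! ### The order and its covering relations -/

namespace FPFInvolution

variable {n : ℕ} {x y : FPFInvolution n} {i j d : Fin (2 * n)}

/-- The Bruhat order on fixed-point-free involutions is the comparison of prefix counts: if the
counts of `x` dominate those of `y`, a sequence of falls leads from `y` down to `x`. -/
theorem le_iff_prefixCount_le :
    x ≤ y ↔ ∀ p q, prefixCount y.perm p q ≤ prefixCount x.perm p q := by
  refine ⟨fun h => BruhatLE.prefixCount_le h, fun h => ?_⟩
  induction hN : invNumber y.perm using Nat.strong_induction_on generalizing y with
  | _ N ih =>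
    by_cases hxy : x = y
    · exact hxy.le
    · obtain ⟨d, hd, hne⟩ := exists_first_apply_ne fun e => hxy (FPFInvolution.ext e)
      obtain ⟨j, hf, -, -, hle⟩ := exists_fall_of_prefixCount_le h hd hne
      exact (ih _ (by have := hf.invNumber_lower; omega) hle rfl).trans hf.lower_lt.le

/-- Below `y`, at the first position `d` where `x` and `y` differ, there is a fall `(d, j)` of `y`
that stays above `x`; the smallest `j > d` with `x d ≤ y j < y d` is such. -/
theorem exists_isFall (hxy : x ≤ y) (hd : ∀ k < d, x.perm k = y.perm k)
    (hne : x.perm d ≠ y.perm d) :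
    ∃ j, ∃ h : IsFall y d j, x ≤ h.lower ∧ x.perm d ≤ y.perm j ∧
      ∀ k, d < k → x.perm d ≤ y.perm k → y.perm k < y.perm d → j ≤ k := by
  obtain ⟨j, hf, h1, h2, h3⟩ :=
    exists_fall_of_prefixCount_le (le_iff_prefixCount_le.1 hxy) hd hne
  exact ⟨j, hf, le_iff_prefixCount_le.2 h3, h1,
    fun k k1 k2 k3 => not_lt.1 fun k4 => h2 k k1 k4 k2 k3⟩

theorem exists_isFall_of_lt (hxy : x < y) : ∃ i j, ∃ h : IsFall y i j, x ≤ h.lower := by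
  obtain ⟨d, hd, hne⟩ := exists_first_apply_ne fun e => hxy.ne (FPFInvolution.ext e)
  obtain ⟨j, hf, h, -⟩ := exists_isFall hxy.le hd hne
  exact ⟨d, j, hf, h⟩

theorem apply_le_of_le (hxy : x ≤ y) (hd : ∀ k < d, x.perm k = y.perm k) :
    x.perm d ≤ y.perm d :=
  apply_le_of_prefixCount_le (le_iff_prefixCount_le.1 hxy) hd

theorem invNumber_le (hxy : x ≤ y) : invNumber x.perm ≤ invNumber y.perm := by
  rcases BruhatLE.eq_or_lt hxy with h | h
  · rw [h]
  · exact h.le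

theorem invNumber_add_two_le (hxy : x < y) : invNumber x.perm + 2 ≤ invNumber y.perm := by
  obtain ⟨i, j, hf, h⟩ := exists_isFall_of_lt hxy
  have := hf.invNumber_lower
  have := invNumber_le h
  omega

theorem covBy_of_invNumber (hxy : x < y) (h : invNumber y.perm ≤ invNumber x.perm + 2) :
    x ⋖ y := by
  refine ⟨hxy, fun z h1 h2 => ?_⟩
  have := invNumber_add_two_le h1
  have := invNumber_add_two_le h2
  omega

theorem IsFall.lower_covBy (h : IsFall y i j) : h.lower ⋖ y :=
  covBy_of_invNumber h.lower_lt h.invNumber_lower.ge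

theorem covBy_iff : x ⋖ y ↔ ∃ i j, ∃ h : IsFall y i j, x = h.lower := by
  constructor
  · intro h
    obtain ⟨i, j, hf, hle⟩ := exists_isFall_of_lt h.1
    exact ⟨i, j, hf, hle.eq_of_not_lt fun hlt => h.2 hlt hf.lower_lt⟩
  · rintro ⟨i, j, h, rfl⟩
    exact h.lower_covBy

theorem invNumber_of_covBy (h : x ⋖ y) : invNumber x.perm + 2 = invNumber y.perm := by
  obtain ⟨i, j, hf, rfl⟩ := covBy_iff.1 h
  exact hf.invNumber_lower

theorem invNumber_add_length (c : SatChain x y) :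
    invNumber x.perm + 2 * c.length = invNumber y.perm := by
  induction c with
  | nil => rfl
  | cons h c ih =>
    have := invNumber_of_covBy h
    rw [SatChain.length]
    omega

/-- The fall of a covering relation is determined by its two elements: `i` is the first position
where they differ, and `j` is the partner in `y` of the partner of `i` in `x`. -/
theorem IsFall.eq_of_lower_eq {i' j' : Fin (2 * n)} (h : IsFall y i j) (h' : IsFall y i' j')
    (e : h.lower = h'.lower) : i = i' ∧ j = j' := by
  have ne : ∀ {i j} (h : IsFall y i j), h.lower.perm i ≠ y.perm i := fun h => by
    rw [h.lower_apply_left]; exact h.apply_lt.ne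
  have hi : i = i' := by
    rcases lt_trichotomy i i' with hlt | heq | hlt
    · exact absurd (e ▸ h'.lower_apply_of_lt hlt) (ne h)
    · exact heq
    · exact absurd (e.symm ▸ h.lower_apply_of_lt hlt) (ne h')
  subst hi
  refine ⟨rfl, y.perm.injective ?_⟩
  rw [← h.lower_apply_left, ← h'.lower_apply_left, e]

/-! ### Minimum and maximum -/

instance : Finite (FPFInvolution n) :=
  Finite.of_injective FPFInvolution.perm fun _ _ h => FPFInvolution.ext h

/-- The involution `(0, 1)(2, 3)⋯(2n-2, 2n-1)`. -/
def adjacent (n : ℕ) : FPFInvolution n :=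
  have h : Function.Involutive fun k : Fin (2 * n) =>
      (⟨if (k : ℕ) % 2 = 0 then k + 1 else k - 1, by split_ifs <;> omega⟩ : Fin (2 * n)) :=
    fun k => Fin.ext <| by
      simp only
      split_ifs <;> omega
  { perm := h.toPerm
    involutive := h
    fixedPointFree := fun k hk => by
      have hk' := congrArg Fin.val hk
      change (if (k : ℕ) % 2 = 0 then (k + 1 : ℕ) else k - 1) = k at hk'
      split_ifs at hk' <;> omega }

theorem adjacent_apply (k : Fin (2 * n)) :
    ((adjacent n).perm k : ℕ) = if (k : ℕ) % 2 = 0 then (k + 1 : ℕ) else k - 1 := rfl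

/-- `x` restricts to a fixed-point-free involution of `{k < p | x k < p}`. -/
theorem even_prefixCount (x : FPFInvolution n) (p : ℕ) : Even (prefixCount x.perm p p) := by
  have : ∑ k ∈ Finset.univ.filter fun k : Fin (2 * n) => (k : ℕ) < p ∧ (x.perm k : ℕ) < p,
      (1 : ZMod 2) = 0 := by
    refine Finset.sum_involution (fun k _ => x.perm k) (fun _ _ => by decide)
      (fun k _ _ => x.fixedPointFree k) (fun k hk => ?_) (fun k _ => x.involutive k)
    simp only [Finset.mem_filter, Finset.mem_univ, true_and] at hk ⊢
    rw [x.involutive]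
    exact hk.symm
  rw [Finset.sum_const, nsmul_one] at this
  exact (ZMod.natCast_eq_zero_iff_even).1 this

theorem adjacent_le (x : FPFInvolution n) : adjacent n ≤ x := by
  rw [le_iff_prefixCount_le]
  intro p q
  wlog hpq : p ≤ q generalizing p q
  · rw [prefixCount_comm x.involutive, prefixCount_comm (adjacent n).involutive]
    exact this q p (not_le.1 hpq).le
  by_cases h : p < q ∨ p % 2 = 0 ∨ 2 * n ≤ p
  · refine Finset.card_le_card fun k hk => ?_
    simp only [Finset.mem_filter, Finset.mem_univ, true_and] at hk ⊢
    rw [adjacent_apply]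
    split_ifs <;> omega
  · obtain rfl : p = q := by omega
    -- `p` is odd, so `x` does not preserve the first `p` points, but `adjacent n` preserves the
    -- first `p - 1`.
    have h1 : prefixCount x.perm p p ≤ p := by
      refine (Finset.card_le_card (t := Finset.univ.filter fun k : Fin (2 * n) => (k : ℕ) < p)
        fun k hk => ?_).trans ?_
      · simp only [Finset.mem_filter, Finset.mem_univ, true_and] at hk ⊢
        exact hk.1
      · rw [Fin.card_filter_val_lt]; exact min_le_right _ _
    have h2 : p - 1 ≤ prefixCount (adjacent n).perm p p := by
      refine le_trans ?_ (Finset.card_le_card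
        (s := Finset.univ.filter fun k : Fin (2 * n) => (k : ℕ) < p - 1) fun k hk => ?_)
      · rw [Fin.card_filter_val_lt]; omega
      · simp only [Finset.mem_filter, Finset.mem_univ, true_and] at hk ⊢
        rw [adjacent_apply]
        split_ifs <;> omega
    obtain ⟨r, hr⟩ := even_prefixCount x p
    omega

/-- The involution `k ↦ 2n - 1 - k`. -/
def reversal (n : ℕ) : FPFInvolution n where
  perm := Fin.revPerm
  involutive k := by simp
  fixedPointFree k := by
    rw [Fin.revPerm_apply, Ne, Fin.ext_iff, Fin.val_rev]
    omega

theorem le_reversal (x : FPFInvolution n) : x ≤ reversal n := by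
  rw [le_iff_prefixCount_le]
  intro p q
  -- By inclusion-exclusion a prefix count and the size of a union have a fixed sum.
  have key : ∀ y : FPFInvolution n, prefixCount y.perm p q +
      (Finset.univ.filter fun k : Fin (2 * n) => (k : ℕ) < p ∨ (y.perm k : ℕ) < q).card =
      (Finset.univ.filter fun k : Fin (2 * n) => (k : ℕ) < p).card +
      (Finset.univ.filter fun k : Fin (2 * n) => (k : ℕ) < q).card := by
    intro y
    have e : (Finset.univ.filter fun k : Fin (2 * n) => (k : ℕ) < q).card =
        (Finset.univ.filter fun k : Fin (2 * n) => (y.perm k : ℕ) < q).card :=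
      (Finset.card_equiv y.perm fun k => by simp).symm
    rw [e, ← Finset.card_inter_add_card_union, ← Finset.filter_and, ← Finset.filter_or, prefixCount]
  have h1 := key x
  have h2 := key (reversal n)
  have rev : ∀ k : Fin (2 * n), ((reversal n).perm k : ℕ) = 2 * n - (k + 1) := fun k =>
    Fin.val_rev k
  by_cases h : p + q ≤ 2 * n
  · have : prefixCount (reversal n).perm p q = 0 := by
      rw [prefixCount, Finset.card_eq_zero, Finset.filter_eq_empty_iff]
      intro k _
      rw [rev]
      omega
    omega
  · have : (Finset.univ.filter fun k : Fin (2 * n) => (k : ℕ) < p ∨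
        ((reversal n).perm k : ℕ) < q) = Finset.univ := by
      refine Finset.filter_true_of_mem fun k _ => ?_
      rw [rev]
      omega
    rw [this] at h2
    have := Finset.card_le_univ
      (Finset.univ.filter fun k : Fin (2 * n) => (k : ℕ) < p ∨ (x.perm k : ℕ) < q)
    rw [Finset.card_univ] at h2
    omega

end FPFInvolution

/-! ### A criterion for EL-labelings -/

namespace SatChain

variable {P : Type} [PartialOrder P] {Γ : Type} {x y z : P}

theorem le (c : SatChain x y) : x ≤ y := by
  induction c with
  | nil => exact le_rfl
  | cons h _ ih => exact h.le.trans ih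

/-- A saturated chain extended by a covering relation at its top. -/
def snoc : {x y z : P} → SatChain x y → y ⋖ z → SatChain x z
  | _, _, _, nil _, h => cons h (nil _)
  | _, _, _, cons h' c, h => cons h' (c.snoc h)

theorem labels_snoc (f : CoverRel P → Γ) (c : SatChain x y) (h : y ⋖ z) :
    (c.snoc h).labels f = c.labels f ++ [f ⟨(y, z), h⟩] := by
  induction c with
  | nil => rfl
  | cons h' c ih => rw [snoc, labels, labels, ih, List.cons_append]

theorem exists_eq_snoc (c : SatChain x y) (hxy : x ≠ y) :
    ∃ (y' : P) (h : y' ⋖ y) (c' : SatChain x y'), c = c'.snoc h := by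
  induction c with
  | nil => exact absurd rfl hxy
  | @cons x v y h c ih =>
    by_cases hv : v = y
    · subst hv
      cases c with
      | nil => exact ⟨x, h, nil x, rfl⟩
      | cons h' c' => exact absurd (h'.lt.trans_le c'.le) (lt_irrefl _)
    · obtain ⟨y', h', c', rfl⟩ := ih hv
      exact ⟨y', h', cons h c', rfl⟩

theorem eq_nil (c : SatChain x x) : c = nil x := by
  cases c with
  | nil => rfl
  | cons h c => exact absurd (h.lt.trans_le c.le) (lt_irrefl _)

end SatChain

section Criterion

variable {P : Type} [PartialOrder P] [Finite P] {Γ : Type} [LinearOrder Γ] {f : CoverRel P → Γ}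

/-- If every descent of a chain can be replaced by a step with a smaller first label, then every
saturated chain is lexicographically at least some weakly increasing one. -/
theorem SatChain.exists_increasing_le [WellFoundedLT Γ]
    (hdescent : ∀ (u v w : P) (h : u ⋖ v) (h' : v ⋖ w), f ⟨(v, w), h'⟩ < f ⟨(u, v), h⟩ →
      ∃ (v' : P) (k : u ⋖ v') (_ : v' ⋖ w), f ⟨(u, v'), k⟩ < f ⟨(u, v), h⟩)
    (y x : P) (d : SatChain x y) :
    ∃ c : SatChain x y, (c.labels f).Pairwise (· ≤ ·) ∧ c.labels f ≤ d.labels f := by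
  induction x using WellFoundedGT.induction with
  | _ x ih =>
    have key : ∀ (g : Γ) (v : P) (h : x ⋖ v) (c : SatChain v y), f ⟨(x, v), h⟩ = g →
        (c.labels f).Pairwise (· ≤ ·) → ∃ c' : SatChain x y, (c'.labels f).Pairwise (· ≤ ·) ∧
          c'.labels f ≤ (SatChain.cons h c).labels f := by
      intro g
      induction g using WellFoundedLT.induction with
      | _ g ihg =>
        intro v h c hg hc
        by_cases hinc : ((SatChain.cons h c).labels f).Pairwise (· ≤ ·)
        · exact ⟨_, hinc, le_rfl⟩
        · cases c with
          | nil => exact absurd (List.pairwise_singleton _ _) hinc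
          | @cons _ w _ h' c =>
            have hlt : f ⟨(v, w), h'⟩ < f ⟨(x, v), h⟩ := by
              by_contra hle
              rw [not_lt] at hle
              refine hinc (List.pairwise_cons.2 ⟨fun a ha => ?_, hc⟩)
              rcases List.mem_cons.1 ha with rfl | ha
              · exact hle
              · exact hle.trans ((List.pairwise_cons.1 hc).1 a ha)
            obtain ⟨v', k, k', hk⟩ := hdescent _ _ _ h h' hlt
            obtain ⟨c₁, hc₁, -⟩ := ih v' k.lt (SatChain.cons k' c)
            obtain ⟨c₂, hc₂, hle⟩ := ihg _ (hg ▸ hk) v' k c₁ rfl hc₁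
            exact ⟨c₂, hc₂, hle.trans (le_of_lt (List.Lex.rel hk))⟩
    cases d with
    | nil => exact ⟨SatChain.nil _, List.Pairwise.nil, le_rfl⟩
    | @cons _ v _ h d =>
      obtain ⟨c, hc, hle⟩ := ih v h.lt d
      obtain ⟨c', hc', hle'⟩ := key _ v h c rfl hc
      refine ⟨c', hc', hle'.trans ?_⟩
      exact List.cons_le_cons _ hle

/-- A criterion for EL-labelings, with a condition on the tops of intervals (for uniqueness) and
one on the descents of chains of length two (for existence and lexicographic minimality). -/
theorem isELLabeling_of_coatoms [WellFoundedLT Γ]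
    (hcoatom : ∀ x y : P, x < y → ∃ (y₁ : P) (h₁ : y₁ ⋖ y), x ≤ y₁ ∧
      ∀ (y' : P) (h : y' ⋖ y), x ≤ y' → y' ≠ y₁ → f ⟨(y', y), h⟩ ≤ f ⟨(y₁, y), h₁⟩ ∧
        ∃ (y'' : P) (h' : y'' ⋖ y'), x ≤ y'' ∧ f ⟨(y', y), h⟩ < f ⟨(y'', y'), h'⟩)
    (hdescent : ∀ (u v w : P) (h : u ⋖ v) (h' : v ⋖ w), f ⟨(v, w), h'⟩ < f ⟨(u, v), h⟩ →
      ∃ (v' : P) (k : u ⋖ v') (_ : v' ⋖ w), f ⟨(u, v'), k⟩ < f ⟨(u, v), h⟩) :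
    IsELLabeling f := by
  have chain : ∀ x y : P, x ≤ y → Nonempty (SatChain x y) := by
    intro x y
    induction y using WellFoundedLT.induction with
    | _ y ih =>
      intro hxy
      rcases hxy.eq_or_lt with rfl | hlt
      · exact ⟨SatChain.nil x⟩
      · obtain ⟨y₁, h₁, hle, -⟩ := hcoatom x y hlt
        obtain ⟨c⟩ := ih y₁ h₁.lt hle
        exact ⟨c.snoc h₁⟩
  choose! t ht hle ht' using hcoatom
  -- The last step of an increasing chain starts at the distinguished coatom.
  have last : ∀ (x y y' : P) (h : y' ⋖ y) (c : SatChain x y'),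
      ((c.snoc h).labels f).Pairwise (· ≤ ·) → y' = t x y := by
    intro x y
    induction y using WellFoundedLT.induction with
    | _ y ih =>
      intro y' h c hc
      by_contra hne
      obtain ⟨-, y'', h'', hx, hlt⟩ := ht' x y (c.le.trans_lt h.lt) y' h c.le hne
      have hxy' : x < y' := hx.trans_lt h''.lt
      obtain ⟨z, hz, c', rfl⟩ := c.exists_eq_snoc hxy'.ne
      rw [SatChain.labels_snoc, List.pairwise_append] at hc
      have hz' := ih y' h.lt z hz c' hc.1
      have h1 : f ⟨(z, y'), hz⟩ ≤ f ⟨(y', y), h⟩ :=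
        hc.2.2 _ (by rw [SatChain.labels_snoc]; simp) _ (by simp)
      have h2 : f ⟨(y'', y'), h''⟩ ≤ f ⟨(z, y'), hz⟩ := by
        by_cases e : y'' = t x y'
        · subst hz'
          subst e
          exact le_rfl
        · subst hz'
          exact (ht' x y' hxy' y'' h'' hx e).1
      exact (hlt.trans_le (h2.trans h1)).false
  have unique : ∀ (x y : P) (c d : SatChain x y), (c.labels f).Pairwise (· ≤ ·) →
      (d.labels f).Pairwise (· ≤ ·) → c = d := by
    intro x y
    induction y using WellFoundedLT.induction with
    | _ y ih =>
      intro c d hc hd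
      by_cases hxy : x = y
      · subst hxy
        rw [c.eq_nil, d.eq_nil]
      · obtain ⟨y', h, c, rfl⟩ := c.exists_eq_snoc hxy
        obtain ⟨y'', h', d, rfl⟩ := d.exists_eq_snoc hxy
        obtain rfl : y' = y'' := (last _ _ _ h c hc).trans (last _ _ _ h' d hd).symm
        rw [SatChain.labels_snoc, List.pairwise_append] at hc hd
        rw [ih y' h.lt c d hc.1 hd.1]
  constructor
  · intro x y hxy
    obtain ⟨d⟩ := chain x y hxy.le
    obtain ⟨c, hc, -⟩ := SatChain.exists_increasing_le hdescent y x d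
    exact ⟨c, hc, fun c' hc' => unique x y c' c hc' hc⟩
  · intro x y _ c d hc
    obtain ⟨c', hc', hcd⟩ := SatChain.exists_increasing_le hdescent y x d
    rw [unique x y c c' hc hc']
    exact hcd.eq_or_lt

end Criterion

/-! ### The rise labeling -/

namespace FPFInvolution

variable {n : ℕ} {f : CoverRel (FPFInvolution n) → (Fin (2 * n) ×ₗ Fin (2 * n))ᵒᵈ}

theorem covBy_iff_isRiseMove {x y : FPFInvolution n} : x ⋖ y ↔ ∃ i j, IsRiseMove x y i j := by
  simp only [covBy_iff, isRiseMove_iff]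

theorem exists_isRiseLabeling (n : ℕ) :
    ∃ f : CoverRel (FPFInvolution n) → (Fin (2 * n) ×ₗ Fin (2 * n))ᵒᵈ, IsRiseLabeling f := by
  choose a b hab using fun e : CoverRel (FPFInvolution n) => covBy_iff.1 e.2
  refine ⟨fun e => OrderDual.toDual (toLex (a e, b e)), fun e i j => ?_⟩
  obtain ⟨h, he⟩ := hab e
  rw [isRiseMove_iff, OrderDual.toDual_inj, toLex_inj, Prod.mk.injEq]
  constructor
  · rintro ⟨rfl, rfl⟩
    exact ⟨h, he⟩
  · rintro ⟨h', he'⟩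
    exact h.eq_of_lower_eq h' (he ▸ he')

theorem IsFall.label_eq (hf : IsRiseLabeling f) {y : FPFInvolution n} {i j : Fin (2 * n)}
    (h : IsFall y i j) (hc : h.lower ⋖ y) :
    f ⟨(h.lower, y), hc⟩ = OrderDual.toDual (toLex (i, j)) :=
  (hf _ i j).2 h.isRiseMove

theorem toDual_toLex_lt {i j i' j' : Fin (2 * n)} :
    OrderDual.toDual (toLex (i, j)) < OrderDual.toDual (toLex (i', j')) ↔
      i' < i ∨ i' = i ∧ j' < j := by
  rw [OrderDual.toDual_lt_toDual, Prod.Lex.toLex_lt_toLex]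

/-- Falls `(i, j)` of `y` with lower element above `x` begin no earlier than the first
difference `d` of `x` and `y`. -/
theorem IsFall.le_of_le_lower {x y : FPFInvolution n} {i j d : Fin (2 * n)} (h : IsFall y i j)
    (hx : x ≤ h.lower) (hd : ∀ k < d, x.perm k = y.perm k) : d ≤ i := by
  by_contra hlt
  rw [not_le] at hlt
  have := apply_le_of_le hx fun k hk => by rw [hd k (hk.trans hlt), h.lower_apply_of_lt hk]
  rw [hd i hlt, h.lower_apply_left] at this
  exact this.not_gt h.apply_lt

/-- Below `y`, the coatom of `[x, y]` with the largest label exists, and every other coatom `y'`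
of `[x, y]` covers an element of `[x, y']` with a larger label. -/
theorem exists_coatom (hf : IsRiseLabeling f) {x y : FPFInvolution n} (hxy : x < y) :
    ∃ (y₁ : FPFInvolution n) (h₁ : y₁ ⋖ y), x ≤ y₁ ∧
      ∀ (y' : FPFInvolution n) (h : y' ⋖ y), x ≤ y' → y' ≠ y₁ →
        f ⟨(y', y), h⟩ ≤ f ⟨(y₁, y), h₁⟩ ∧
        ∃ (y'' : FPFInvolution n) (h' : y'' ⋖ y'), x ≤ y'' ∧
          f ⟨(y', y), h⟩ < f ⟨(y'', y'), h'⟩ := by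
  obtain ⟨d, hd, hne⟩ := exists_first_apply_ne fun e => hxy.ne (FPFInvolution.ext e)
  obtain ⟨j, hj, hxj, haj, hmin⟩ := exists_isFall hxy.le hd hne
  refine ⟨hj.lower, hj.lower_covBy, hxj, fun y' hc hxy' hne' => ?_⟩
  obtain ⟨i, j', h', rfl⟩ := covBy_iff.1 hc
  have hdi := h'.le_of_le_lower hxy' hd
  have hd' : ∀ k < d, x.perm k = h'.lower.perm k := fun k hk => by
    rw [hd k hk, h'.lower_apply_of_lt (hk.trans_le hdi)]
  rw [hj.label_eq hf, h'.label_eq hf]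
  rcases hdi.lt_or_eq with hlt | rfl
  · refine ⟨(toDual_toLex_lt.2 (Or.inl hlt)).le, ?_⟩
    obtain ⟨j'', h'', hx'', -⟩ := exists_isFall hxy' hd' (by rwa [h'.lower_apply_of_lt hlt])
    refine ⟨h''.lower, h''.lower_covBy, hx'', ?_⟩
    rw [h''.label_eq hf]
    exact toDual_toLex_lt.2 (Or.inl hlt)
  · have hle : x.perm d ≤ y.perm j' := by
      rw [← h'.lower_apply_left]
      exact apply_le_of_le hxy' hd'
    have hjj' : j < j' := by
      refine lt_of_le_of_ne (hmin j' h'.lt hle h'.apply_lt) ?_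
      rintro rfl
      exact hne' rfl
    refine ⟨(toDual_toLex_lt.2 (Or.inr ⟨rfl, hjj'⟩)).le, ?_⟩
    -- Freeness of `(d, j')` keeps the value of `y` at `j` below the new value at `d`.
    have hval : y.perm j < y.perm j' := by
      refine lt_of_le_of_ne (not_lt.1 fun h => ?_) (y.perm.injective.ne hjj'.ne)
      exact h'.free j hj.lt hjj' h hj.apply_lt
    have hyj : h'.lower.perm j = y.perm j := by
      have h1 : j ≠ y.perm d := by
        rintro rfl
        have := hj.lt_apply
        rw [y.involutive] at this
        exact this.false
      have h2 : j ≠ y.perm j' := by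
        intro h
        rw [h, y.involutive, ← h] at hval
        exact hval.not_gt hjj'
      rw [h'.lower_apply, if_neg hj.lt.ne', if_neg hjj'.ne, if_neg h1, if_neg h2]
    obtain ⟨j'', h'', hx'', -, hmin''⟩ := exists_isFall hxy' hd' (by
      rw [h'.lower_apply_left]
      exact (haj.trans_lt hval).ne)
    refine ⟨h''.lower, h''.lower_covBy, hx'', ?_⟩
    rw [h''.label_eq hf]
    refine toDual_toLex_lt.2 (Or.inr ⟨rfl, lt_of_le_of_lt (hmin'' j hj.lt ?_ ?_) hjj'⟩)
    · rwa [hyj]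
    · rwa [hyj, h'.lower_apply_left]

/-- A descent `u ⋖ v ⋖ w` is bypassed by the coatom `v'` of `[u, w]` with the largest label: at the
first difference `d` of `u` and `w` it has `v' d < v d`, so `u ⋖ v'` has a smaller label. -/
theorem exists_bypass (hf : IsRiseLabeling f) {u v w : FPFInvolution n} (huv : u ⋖ v)
    (hvw : v ⋖ w) (hlt : f ⟨(v, w), hvw⟩ < f ⟨(u, v), huv⟩) :
    ∃ (v' : FPFInvolution n) (k : u ⋖ v') (_ : v' ⋖ w),
      f ⟨(u, v'), k⟩ < f ⟨(u, v), huv⟩ := by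
  obtain ⟨i, j₂, h₂, rfl⟩ := covBy_iff.1 hvw
  obtain ⟨d, j₁, h₁, rfl⟩ := covBy_iff.1 huv
  rw [h₁.label_eq hf, h₂.label_eq hf, toDual_toLex_lt] at hlt
  have hdi : d ≤ i := by rcases hlt with h | h; exacts [h.le, h.1.le]
  set v := h₂.lower
  set u := h₁.lower
  have hd : ∀ k < d, u.perm k = w.perm k := fun k hk => by
    rw [h₁.lower_apply_of_lt hk, h₂.lower_apply_of_lt (hk.trans_le hdi)]
  have huvd : u.perm d < v.perm d := by
    rw [h₁.lower_apply_left]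
    exact h₁.apply_lt
  have hvwd : v.perm d ≤ w.perm d := apply_le_of_le hvw.le fun k hk => by
    rw [h₂.lower_apply_of_lt (hk.trans_le hdi)]
  have hne : u.perm d ≠ w.perm d := (huvd.trans_le hvwd).ne
  obtain ⟨j, hj, huj, haj, hmin⟩ := exists_isFall (huv.le.trans hvw.le) hd hne
  have n₁ : invNumber u.perm + 2 = invNumber v.perm := invNumber_of_covBy huv
  have n₂ : invNumber v.perm + 2 = invNumber w.perm := invNumber_of_covBy hvw
  have n₃ := hj.invNumber_lower
  have hu : u < hj.lower := lt_of_le_of_ne huj fun e => by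
    rw [← e] at n₃
    omega
  have hcov : u ⋖ hj.lower := covBy_of_invNumber hu (by omega)
  refine ⟨hj.lower, hcov, hj.lower_covBy, ?_⟩
  -- The coatom `hj.lower` has a smaller value at `d` than `v`.
  have hv'v : hj.lower.perm d < v.perm d := by
    rw [hj.lower_apply_left]
    rcases hlt with hlt | ⟨rfl, hlt⟩
    · rw [h₂.lower_apply_of_lt hlt]
      exact hj.apply_lt
    · have hdj₁ := h₁.lt_apply
      have hw : w.perm j₁ = u.perm d := by
        rw [h₁.lower_apply_left]
        have e := h₂.lower_apply j₁
        rw [if_neg h₁.lt.ne', if_neg hlt.ne] at e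
        split_ifs at e with e1 e2
        · rw [h₁.lower_apply_left] at huvd
          have := huvd.trans_le hvwd
          rw [e, ← e1] at this
          exact absurd this hlt.not_gt
        · rw [e] at hdj₁
          exact absurd hdj₁ (lt_irrefl _)
        · exact e.symm
      have hjj₁ : j ≤ j₁ :=
        hmin j₁ h₁.lt hw.ge (by rw [hw]; exact huvd.trans_le hvwd)
      have hjj₂ := hjj₁.trans_lt hlt
      rw [h₂.lower_apply_left]
      exact lt_of_le_of_ne (not_lt.1 fun h => h₂.free j hj.lt hjj₂ h hj.apply_lt)
        (w.perm.injective.ne hjj₂.ne)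
  obtain ⟨i₃, j₃, h₃, e₃⟩ := covBy_iff.1 hcov
  have hlab : f ⟨(u, hj.lower), hcov⟩ = OrderDual.toDual (toLex (i₃, j₃)) :=
    (hf _ i₃ j₃).2 (isRiseMove_iff.2 ⟨h₃, e₃⟩)
  rw [hlab, h₁.label_eq hf, toDual_toLex_lt]
  have hdi₃ : d ≤ i₃ := h₃.le_of_le_lower e₃.le fun k hk => by
    rw [hd k hk, hj.lower_apply_of_lt hk]
  rcases hdi₃.lt_or_eq with h | rfl
  · exact Or.inl h
  · refine Or.inr ⟨rfl, ?_⟩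
    -- Both `(d, j₁)` and `(d, j₃)` are rises of `u`, so the larger value belongs to the smaller
    -- index.
    have u₁ : u.perm j₁ = v.perm d := h₁.lower_apply_right
    have u₃ : u.perm j₃ = hj.lower.perm d := by rw [e₃]; exact h₃.lower_apply_right
    have hfree : IsFreeRise u.perm d j₁ := by
      rcases h₁.isRiseMove.1 with h | h
      exacts [h.1, h.1]
    have hud : u.perm d < u.perm j₃ := by
      rw [u₃, e₃, h₃.lower_apply_left]
      exact h₃.apply_lt
    have hlt₃ : u.perm j₃ < u.perm j₁ := by rwa [u₁, u₃]
    refine lt_of_le_of_ne (not_lt.1 fun h => hfree.2.2 ⟨j₃, h₃.lt, h, hud, hlt₃⟩) ?_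
    rintro rfl
    exact hlt₃.false

theorem _root_.IsRiseLabeling.isELLabeling (hf : IsRiseLabeling f) : IsELLabeling f :=
  haveI : Finite (Fin (2 * n) ×ₗ Fin (2 * n))ᵒᵈ :=
    inferInstanceAs (Finite (Fin (2 * n) × Fin (2 * n)))
  isELLabeling_of_coatoms (fun _ _ h => exists_coatom hf h)
    fun _ _ _ h h' hlt => exists_bypass hf h h' hlt

end FPFInvolution

theorem theorem3p1 (n : ℕ) :
    IsELShellable (FPFInvolution n) ∧
    (∀ x y : FPFInvolution n, x ⋖ y ↔ ∃ i j, IsRiseMove x y i j) ∧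
    ∃ f : CoverRel (FPFInvolution n) → (Fin (2 * n) ×ₗ Fin (2 * n))ᵒᵈ,
      IsRiseLabeling f ∧ IsELLabeling f := by
  obtain ⟨f, hf⟩ := FPFInvolution.exists_isRiseLabeling n
  refine ⟨⟨inferInstance, ⟨FPFInvolution.adjacent n, FPFInvolution.adjacent_le⟩,
    ⟨FPFInvolution.reversal n, FPFInvolution.le_reversal⟩, fun x y c d => ?_,
    ⟨_, _, f, hf.isELLabeling⟩⟩, fun x y => FPFInvolution.covBy_iff_isRiseMove,
    ⟨f, hf, hf.isELLabeling⟩⟩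
  have hc := FPFInvolution.invNumber_add_length c
  have hd := FPFInvolution.invNumber_add_length d
  omega
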